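/- Let $\mathbb T=\mathbb R/\mathbb Z$ be the circle with its usual metric, let $D(x)=2x \bmod 1$ be the doubling map, and let $\mathcal K_D$ be the family of all compact sets $K\subseteq\mathbb T$ with $D(K)\subseteq K$. For $\alpha\in(1,\infty]$ let $\mathcal E^\alpha$ be the set of all expanding Markov maps of the circle of class $C^\alpha$, i.e. of all local homeomorphisms $f:\mathbb T\to\mathbb T$ of class $C^\alpha$ for which there is a $\gamma>1$ with $|f'(x)|>\gamma$ for all $x\in\mathbb T$, and for which finitely many points divide $\mathbb T$ into arcs that $f$ maps onto $\mathbb T$, injectively on the interior of each arc. (For finite non-integer $\alpha$, class $C^\alpha$ means $C^{\lfloor\alpha\rfloor}$ with $f^{(\lfloor\alpha\rfloor)}$ Hölder continuous of exponent $\alpha-\lfloor\alpha\rfloor$.) Endow $\mathcal E^\alpha$ with the $C^\alpha$ topology: for $\alpha<\infty$ the topology of the distance $$\|f-g\|_{C^\alpha}=\sup_{x} d_{\mathbb T}(f(x),g(x))+\sum_{j=1}^{\lfloor\alpha\rfloor}\sup_x|f^{(j)}(x)-g^{(j)}(x)|+\bigl[f^{(\lfloor\alpha\rfloor)}-g^{(\lfloor\alpha\rfloor)}\bigr]_{\alpha-\lfloor\alpha\rfloor},$$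 where the last term, the Hölder seminorm, is present only if $\alpha\notin\mathbb Z$; for $\alpha=\infty$ the topology generated by all the distances $\|f-g\|_{C^k}$, $k\ge 1$. Theorem. Let $\alpha\in(1,\infty]$. For generic $f\in\mathcal E^\alpha$, i.e. for all $f$ in some dense $G_\delta$ subset of $\mathcal E^\alpha$, the following holds: for every $K\in\mathcal K_D$ whose Hausdorff dimension is less than $1/2$, $$f(K)\cap K=\varnothing .$$ -/

import Mathlib

open Set Topology
open scoped ENNReal ContDiff

noncomputable section

/-- `F : ℝ → ℝ` is of class `C^a` for finite real `a`: with `k = ⌊a⌋`, `F` is `k` times continuously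
differentiable and, when `a` is not an integer, `F^(k)` is Hölder with exponent `a - k`. -/
def IsClassCReal (a : ℝ) (F : ℝ → ℝ) : Prop :=
  ContDiff ℝ ((⌊a⌋₊ : ℕ) : WithTop ℕ∞) F ∧
    (0 < a - ⌊a⌋₊ → ∃ C : ℝ, ∀ x y : ℝ,
      |iteratedDeriv ⌊a⌋₊ F x - iteratedDeriv ⌊a⌋₊ F y| ≤ C * |x - y| ^ (a - ⌊a⌋₊))

/-- Class `C^α` for `α ≤ ∞`. -/
def IsClassC (α : ℝ≥0∞) (F : ℝ → ℝ) : Prop :=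
  (α = ⊤ → ContDiff ℝ ∞ F) ∧ (α ≠ ⊤ → IsClassCReal α.toReal F)

/-- The uniform distance of two real functions. -/
def supDist (u v : ℝ → ℝ) : ℝ≥0∞ := ⨆ t : ℝ, ENNReal.ofReal |u t - v t|

/-- The Hölder seminorm of `u - v` with exponent `b`. -/
def holderDist (b : ℝ) (u v : ℝ → ℝ) : ℝ≥0∞ :=
  ⨆ (t : ℝ) (t' : ℝ), ENNReal.ofReal (|(u t - v t) - (u t' - v t')| / |t - t'| ^ b)

theorem supDist_comm (u v : ℝ → ℝ) : supDist u v = supDist v u := by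
  simp only [supDist, abs_sub_comm]

theorem supDist_triangle (u v w : ℝ → ℝ) : supDist u w ≤ supDist u v + supDist v w := by
  refine iSup_le fun t => le_trans ?_ (add_le_add
    (le_iSup (fun t => ENNReal.ofReal |u t - v t|) t)
    (le_iSup (fun t => ENNReal.ofReal |v t - w t|) t))
  rw [← ENNReal.ofReal_add (abs_nonneg _) (abs_nonneg _)]
  exact ENNReal.ofReal_le_ofReal (abs_sub_le _ _ _)

theorem holderDist_comm (b : ℝ) (u v : ℝ → ℝ) : holderDist b u v = holderDist b v u := by
  have h : ∀ t t' : ℝ, |(u t - v t) - (u t' - v t')| = |(v t - u t) - (v t' - u t')| := by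
    intro t t'
    rw [← abs_neg]; congr 1; ring
  simp only [holderDist, h]

theorem holderDist_triangle (b : ℝ) (u v w : ℝ → ℝ) :
    holderDist b u w ≤ holderDist b u v + holderDist b v w := by
  refine iSup₂_le fun t t' => le_trans ?_ (add_le_add
    (le_iSup₂ (f := fun t t' : ℝ =>
      ENNReal.ofReal (|(u t - v t) - (u t' - v t')| / |t - t'| ^ b)) t t')
    (le_iSup₂ (f := fun t t' : ℝ =>
      ENNReal.ofReal (|(v t - w t) - (v t' - w t')| / |t - t'| ^ b)) t t'))
  rw [← ENNReal.ofReal_add (by positivity) (by positivity), ← add_div]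
  refine ENNReal.ofReal_le_ofReal (div_le_div_of_nonneg_right ?_ (by positivity))
  refine le_trans (le_of_eq ?_) (abs_add_le _ _)
  congr 1; ring

/-- `F : ℝ → ℝ` is a lift of the self-map `f` of the circle `ℝ / ℤ`. -/
def IsLift (F : ℝ → ℝ) (f : UnitAddCircle → UnitAddCircle) : Prop :=
  ∀ t : ℝ, ((F t : ℝ) : UnitAddCircle) = f (t : UnitAddCircle)

/-- The space `E^α` of expanding Markov maps of the circle of class `C^α`: local homeomorphisms of
class `C^α`, with `|f'| > γ` everywhere for some `γ > 1`, such that finitely many points cut the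
circle into arcs, each of which is mapped onto the whole circle, injectively on its interior.
Regularity and derivatives are those of a lift to the real line. -/
structure ExpandingMarkovMap (α : ℝ≥0∞) where
  toFun : UnitAddCircle → UnitAddCircle
  isLocalHomeomorph : IsLocalHomeomorph toFun
  exists_lift : ∃ F : ℝ → ℝ, IsLift F toFun ∧ Continuous F ∧ IsClassC α F ∧
    ∃ γ : ℝ, 1 < γ ∧ ∀ t : ℝ, γ < |deriv F t|
  exists_partition : ∃ (n : ℕ) (x : Fin (n + 1) → ℝ), StrictMono x ∧ x (Fin.last n) = x 0 + 1 ∧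
    ∀ i : Fin n,
      InjOn toFun ((fun t : ℝ => (t : UnitAddCircle)) '' Ioo (x i.castSucc) (x i.succ)) ∧
      toFun '' ((fun t : ℝ => (t : UnitAddCircle)) '' Icc (x i.castSucc) (x i.succ)) = univ

namespace ExpandingMarkovMap

variable {α : ℝ≥0∞}

instance : CoeFun (ExpandingMarkovMap α) (fun _ => UnitAddCircle → UnitAddCircle) :=
  ⟨ExpandingMarkovMap.toFun⟩

/-- A continuous lift of `f` (unique up to an additive integer constant). -/
def lift (f : ExpandingMarkovMap α) : ℝ → ℝ := f.exists_lift.choose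

theorem isLift_lift (f : ExpandingMarkovMap α) : IsLift f.lift f := f.exists_lift.choose_spec.1

theorem continuous_lift (f : ExpandingMarkovMap α) : Continuous f.lift :=
  f.exists_lift.choose_spec.2.1

/-- The `j`-th derivative of `f`, as a (1-periodic) function on the line; used for `1 ≤ j` only. -/
def derivative (j : ℕ) (f : ExpandingMarkovMap α) : ℝ → ℝ := iteratedDeriv j f.lift

/-- The derivatives do not depend on the continuous lift. -/
theorem derivative_eq (f : ExpandingMarkovMap α) {G : ℝ → ℝ} (hG : Continuous G)
    (hl : IsLift G f) {j : ℕ} (hj : 1 ≤ j) : f.derivative j = iteratedDeriv j G := by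
  have hex : ∀ t, ∃ n : ℤ, (n : ℝ) = f.lift t - G t := by
    intro t
    have h : ((f.lift t - G t : ℝ) : UnitAddCircle) = 0 := by
      rw [AddCircle.coe_sub, f.isLift_lift t, hl t, sub_self]
    obtain ⟨n, hn⟩ := (AddCircle.coe_eq_zero_iff (1 : ℝ)).1 h
    exact ⟨n, by simpa using hn⟩
  choose n hn using hex
  have hc : Continuous n := by
    have h1 : Continuous (fun t => (n t : ℝ)) := by
      simp only [hn]
      exact f.continuous_lift.sub hG
    exact Int.isClosedEmbedding_coe_real.isInducing.continuous_iff.2 h1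
  have hfun : f.lift = fun t => (n 0 : ℝ) + G t := by
    funext t
    have : n t = n 0 := PreconnectedSpace.constant inferInstance hc
    rw [← this, hn]; ring
  obtain ⟨i, rfl⟩ : ∃ i, j = i + 1 := ⟨j - 1, by omega⟩
  unfold derivative
  rw [hfun, iteratedDeriv_succ', iteratedDeriv_succ']
  congr 1
  funext t
  exact deriv_const_add _

/-- The `C^s` distance `‖f - g‖_{C^s}`, for finite `s ≥ 1`: the uniform distance in the circle, the
uniform distances of the derivatives of order `1, …, ⌊s⌋`, and, when `s` is not an integer, the
Hölder seminorm with exponent `s - ⌊s⌋` of the difference of the derivatives of order `⌊s⌋`. -/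
def cDist (s : ℝ) (f g : ExpandingMarkovMap α) : ℝ≥0∞ :=
  (⨆ x : UnitAddCircle, edist (f x) (g x)) +
  (∑ j ∈ Finset.Icc 1 ⌊s⌋₊, supDist (f.derivative j) (g.derivative j)) +
  if 0 < s - ⌊s⌋₊ then holderDist (s - ⌊s⌋₊) (f.derivative ⌊s⌋₊) (g.derivative ⌊s⌋₊) else 0

theorem cDist_self (s : ℝ) (f : ExpandingMarkovMap α) : cDist s f f = 0 := by
  simp [cDist, supDist, holderDist]

theorem cDist_comm (s : ℝ) (f g : ExpandingMarkovMap α) : cDist s f g = cDist s g f := by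
  unfold cDist
  simp only [edist_comm (f _) (g _), supDist_comm (f.derivative _) (g.derivative _),
    holderDist_comm _ (f.derivative _) (g.derivative _)]

theorem cDist_triangle (s : ℝ) (f g h : ExpandingMarkovMap α) :
    cDist s f h ≤ cDist s f g + cDist s g h := by
  unfold cDist
  rw [add_add_add_comm, add_add_add_comm (⨆ x, edist (f x) (g x)), ← Finset.sum_add_distrib]
  refine add_le_add (add_le_add ?_ ?_) ?_
  · exact iSup_le fun x => (edist_triangle _ (g x) _).trans
      (add_le_add (le_iSup (fun x => edist (f x) (g x)) x) (le_iSup (fun x => edist (g x) (h x)) x))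
  · exact Finset.sum_le_sum fun j _ => supDist_triangle _ _ _
  · split_ifs
    · exact holderDist_triangle _ _ _ _
    · simp

/-- The `C^s` distance as a pseudo-metric. -/
abbrev cMetric (α : ℝ≥0∞) (s : ℝ) : PseudoEMetricSpace (ExpandingMarkovMap α) where
  edist := cDist s
  edist_self := cDist_self s
  edist_comm := cDist_comm s
  edist_triangle := cDist_triangle s

open Classical in
/-- The `C^α` topology on `E^α`: the one of the `C^α` norm if `α < ∞`, and the one generated by all
the `C^k` norms, `k ≥ 1`, if `α = ∞`. -/
instance : TopologicalSpace (ExpandingMarkovMap α) :=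
  if α = ⊤ then ⨅ k : ℕ, (cMetric α ((k + 1 : ℕ) : ℝ)).toUniformSpace.toTopologicalSpace
  else (cMetric α α.toReal).toUniformSpace.toTopologicalSpace

end ExpandingMarkovMap

/-- The doubling map of the circle. -/
def doublingMap (x : UnitAddCircle) : UnitAddCircle := x + x

/-- The family `K_f` of compact `f`-invariant subsets of the circle. -/
def compactInvariantSets (f : UnitAddCircle → UnitAddCircle) : Set (Set UnitAddCircle) :=
  {K | IsCompact K ∧ f '' K ⊆ K}

end

/-!
A dense `G_δ` set of maps is found inside the families `f + t`, `t ∈ ℝ / ℤ`, of rotations of single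
maps. Rotating `f` changes none of its derivatives and keeps it an expanding Markov map, so small
rotations are small perturbations in every `C^s` distance
(`ExpandingMarkovMap.cDist_rotate_le`, `ExpandingMarkovMap.tendsto_rotate`).

If a compact set `A` is covered, along some sequence of scales `δ → 0`, by `N` sets of diameter `δ`
with `N ^ 2 * δ → 0`, then the set `A - f(A)` of those `t` for which `(f + t)(A)` meets `A` is
covered by `N ^ 2` sets of diameter `O(δ)`, because `f` is Lipschitz; hence it is Lebesgue null
(`volume_setOf_add_mem_eq_zero`). So almost every `t` is good for `A`, and almost every `t` is good
for countably many such sets at once. In particular density of the countable intersection needs no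
Baire category theorem. For fixed compact `A` the condition `f(A) ∩ A = ∅` is open already for
uniform convergence (`ExpandingMarkovMap.isOpen_setOf_disjoint_image`).

It remains to place the uncountably many invariant sets `K` with `dimH K < 1 / 2` inside countably
many sets `A` of this kind (`exists_subset_confinedSet`). This rests on Furstenberg's theorem that
Hausdorff and box dimension agree for compact sets invariant under doubling, proved in
`exists_coverableBy_of_hausdorffMeasure_eq_zero` in the following form. If the `s`-dimensional
Hausdorff measure of `K` vanishes, then `K` is covered by finitely many balls `Bᵢ` of radius
`2^(-mᵢ) / 4`, `mᵢ ≥ 1`, with `∑ 2^(-s mᵢ) ≤ 1`. The `mᵢ`-th power of the doubling map expands `Bᵢ`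
by exactly `2 ^ mᵢ` and maps `K ∩ Bᵢ` into `K`, so the covering numbers `a n` of `K` at scale `2⁻ⁿ`
satisfy `a n ≤ ∑ a (n - mᵢ)`, whence `a n ≤ const * 2 ^ (s n)` by induction. With `s < 1 / 2`, some
scale `n` has a covering of `K` by fewer than `2 ^ (n / 2)` balls with centres in a fixed countable
dense set, and `A` is the set of points whose orbit under multiplication by `2 ^ n` never leaves
these balls (`confinedSet`).
-/

noncomputable section

/-! ### Coverings by sets of prescribed diameter -/

/-- `A` is covered by at most `N` sets in each of which any two points are at distance at most
`δ`. The sets are arbitrary (not balls), so that coverings can be pulled back by expanding maps. -/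
def CoverableBy {X : Type*} [PseudoMetricSpace X] (A : Set X) (N : ℕ) (δ : ℝ) : Prop :=
  ∃ 𝒮 : Finset (Set X), 𝒮.card ≤ N ∧ (∀ S ∈ 𝒮, ∀ x ∈ S, ∀ y ∈ S, dist x y ≤ δ) ∧
    A ⊆ ⋃ S ∈ 𝒮, S

namespace CoverableBy

variable {X Y : Type*} [PseudoMetricSpace X] [PseudoMetricSpace Y] {A B : Set X} {N M : ℕ}
  {δ ε : ℝ}

theorem mono (h : CoverableBy A N δ) (hBA : B ⊆ A) (hN : N ≤ M) (hδ : δ ≤ ε) :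
    CoverableBy B M ε := by
  obtain ⟨𝒮, hcard, hdiam, hsub⟩ := h
  exact ⟨𝒮, hcard.trans hN, fun S hS x hx y hy => (hdiam S hS x hx y hy).trans hδ,
    hBA.trans hsub⟩

theorem biUnion {ι : Type*} {s : Finset ι} {A : ι → Set X} {N : ι → ℕ}
    (h : ∀ i ∈ s, CoverableBy (A i) (N i) δ) :
    CoverableBy (⋃ i ∈ s, A i) (∑ i ∈ s, N i) δ := by
  classical
  have h' : ∀ i, ∃ 𝒮 : Finset (Set X), i ∈ s → 𝒮.card ≤ N i ∧
      (∀ S ∈ 𝒮, ∀ x ∈ S, ∀ y ∈ S, dist x y ≤ δ) ∧ A i ⊆ ⋃ S ∈ 𝒮, S := by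
    intro i
    by_cases hi : i ∈ s
    · obtain ⟨𝒮, h𝒮⟩ := h i hi
      exact ⟨𝒮, fun _ => h𝒮⟩
    · exact ⟨∅, fun hi' => absurd hi' hi⟩
  choose 𝒮 h𝒮 using h'
  refine ⟨s.biUnion 𝒮, Finset.card_biUnion_le.trans (Finset.sum_le_sum fun i hi => (h𝒮 i hi).1),
    ?_, ?_⟩
  · intro S hS
    obtain ⟨i, hi, hSi⟩ := Finset.mem_biUnion.1 hS
    exact (h𝒮 i hi).2.1 S hSi
  · intro x hx
    obtain ⟨i, hi, hxi⟩ := mem_iUnion₂.1 hx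
    obtain ⟨S, hS, hxS⟩ := mem_iUnion₂.1 ((h𝒮 i hi).2.2 hxi)
    exact mem_iUnion₂.2 ⟨S, Finset.mem_biUnion.2 ⟨i, hi, hS⟩, hxS⟩

/-- Coverings pull back along maps that expand distances on `A` by the factor `c`. -/
theorem of_mapsTo {B : Set Y} {g : X → Y} {c : ℝ} (hc : 0 < c) (h : CoverableBy B N δ)
    (hg : MapsTo g A B) (hexp : ∀ x ∈ A, ∀ y ∈ A, c * dist x y ≤ dist (g x) (g y)) :
    CoverableBy A N (δ / c) := by
  classical
  obtain ⟨𝒮, hcard, hdiam, hsub⟩ := h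
  refine ⟨𝒮.image fun S => A ∩ g ⁻¹' S, Finset.card_image_le.trans hcard, ?_, ?_⟩
  · intro S hS x hx y hy
    obtain ⟨T, hT, rfl⟩ := Finset.mem_image.1 hS
    rw [le_div_iff₀' hc]
    exact (hexp x hx.1 y hy.1).trans (hdiam T hT _ hx.2 _ hy.2)
  · intro x hx
    obtain ⟨S, hS, hxS⟩ := mem_iUnion₂.1 (hsub (hg hx))
    exact mem_iUnion₂.2 ⟨_, Finset.mem_image_of_mem _ hS, hx, hxS⟩

theorem exists_of_isCompact (hA : IsCompact A) (hδ : 0 < δ) : ∃ N, CoverableBy A N δ := by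
  classical
  obtain ⟨t, -, ht, hsub⟩ :=
    Metric.finite_approx_of_totallyBounded hA.totallyBounded (δ / 2) (half_pos hδ)
  refine ⟨_, ht.toFinset.image fun y => Metric.ball y (δ / 2), le_rfl, ?_, ?_⟩
  · intro S hS x hx y hy
    obtain ⟨c, -, rfl⟩ := Finset.mem_image.1 hS
    have := dist_triangle_right x y c
    have hx := Metric.mem_ball.1 hx
    have hy := Metric.mem_ball.1 hy
    linarith
  · intro x hx
    obtain ⟨y, hy, hxy⟩ := mem_iUnion₂.1 (hsub hx)
    exact mem_iUnion₂.2 ⟨_, Finset.mem_image_of_mem _ (ht.mem_toFinset.2 hy), hxy⟩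

/-- The sets of a covering may be replaced by balls of a larger radius centred in a dense
sequence. -/
theorem exists_finset_closedBall (h : CoverableBy A N δ) {u : ℕ → X} (hu : DenseRange u)
    (hδε : δ < ε) :
    ∃ C : Finset ℕ, C.card ≤ N ∧ A ⊆ ⋃ c ∈ C, Metric.closedBall (u c) ε := by
  classical
  obtain ⟨𝒮, hcard, hdiam, hsub⟩ := h
  have h' : ∀ S : Set X, ∃ c : ℕ, S ∈ 𝒮 → S ⊆ Metric.closedBall (u c) ε := by
    intro S
    rcases S.eq_empty_or_nonempty with rfl | ⟨x, hx⟩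
    · exact ⟨0, fun _ => empty_subset _⟩
    · obtain ⟨c, hc⟩ := hu.exists_dist_lt x (sub_pos.2 hδε)
      refine ⟨c, fun hS y hy => Metric.mem_closedBall.2 ?_⟩
      have := hdiam S hS y hy x hx
      have := dist_triangle y x (u c)
      linarith
  choose c hc using h'
  refine ⟨𝒮.image c, Finset.card_image_le.trans hcard, fun x hx => ?_⟩
  obtain ⟨S, hS, hxS⟩ := mem_iUnion₂.1 (hsub hx)
  exact mem_iUnion₂.2 ⟨c S, Finset.mem_image_of_mem _ hS, hc S hS hxS⟩

end CoverableBy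

/-! ### The powers of the doubling map -/

theorem exists_coe_eq_abs_eq_norm (x : UnitAddCircle) :
    ∃ t : ℝ, (t : UnitAddCircle) = x ∧ |t| = ‖x‖ := by
  obtain ⟨t, rfl⟩ := QuotientAddGroup.mk_surjective x
  refine ⟨t - round t, ?_, (UnitAddCircle.norm_eq).symm⟩
  rw [AddCircle.coe_sub, sub_eq_self, AddCircle.coe_eq_zero_iff]
  exact ⟨round t, by simp⟩

theorem norm_coe_le_abs (t : ℝ) : ‖(t : UnitAddCircle)‖ ≤ |t| := by
  rw [UnitAddCircle.norm_eq]
  simpa using round_le t 0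

theorem dist_le_half (x y : UnitAddCircle) : dist x y ≤ 1 / 2 := by
  rw [dist_eq_norm]
  simpa using AddCircle.norm_le_half_period 1 (x := x - y) one_ne_zero

theorem dist_nsmul_eq {k : ℕ} {x y : UnitAddCircle} (h : k * dist x y ≤ 1 / 2) :
    dist (k • x) (k • y) = k * dist x y := by
  rw [dist_eq_norm] at h
  rw [dist_eq_norm, dist_eq_norm, ← smul_sub]
  obtain ⟨t, ht, hn⟩ := exists_coe_eq_abs_eq_norm (x - y)
  have habs : |(k : ℝ) * t| = k * ‖x - y‖ := by rw [abs_mul, hn, Nat.abs_cast]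
  rw [← ht, ← AddCircle.coe_nsmul, nsmul_eq_mul,
    (AddCircle.norm_coe_eq_abs_iff 1 one_ne_zero).2 (by rw [habs]; simpa using h), habs, ht]

/-- A set on which `x ↦ 2 ^ m • x` expands distances by exactly `2 ^ m`, and which that map sends
into `B`, inherits the coverings of `B`, rescaled. -/
theorem CoverableBy.of_two_pow_nsmul {A B : Set UnitAddCircle} {N m : ℕ} {δ : ℝ}
    (h : CoverableBy B N δ) (hmaps : MapsTo (fun x => 2 ^ m • x) A B)
    (hA : ∀ x ∈ A, ∀ y ∈ A, dist x y ≤ 1 / 2 / 2 ^ m) : CoverableBy A N (δ / 2 ^ m) := by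
  refine h.of_mapsTo (by positivity) hmaps fun x hx y hy => ?_
  have := hA x hx y hy
  rw [le_div_iff₀' (by positivity)] at this
  rw [dist_nsmul_eq (by simpa using this)]
  simp

theorem two_pow_nsmul_mem {K : Set UnitAddCircle} (hK : doublingMap '' K ⊆ K) {x : UnitAddCircle}
    (hx : x ∈ K) (m : ℕ) : 2 ^ m • x ∈ K := by
  induction m with
  | zero => simpa using hx
  | succ m ih =>
    rw [pow_succ', mul_smul, two_nsmul]
    exact hK (mem_image_of_mem doublingMap ih)

/-! ### Box-counting bounds for invariant sets of small Hausdorff dimension -/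

/-- A small set lies in a ball of radius `2⁻ᵐ / 4`, `m ≥ 1`, where `2⁻ᵐ` is comparable to its
diameter, or as small as one wishes if the diameter is zero. -/
theorem exists_subset_ball_two_pow {X : Type*} [PseudoMetricSpace X] [Nonempty X] {s : ℝ}
    (hs : 0 < s) {t : Set X} (ht : Metric.ediam t < 2⁻¹ ^ 3) {η : ℝ≥0∞} (hη : η ≠ 0) :
    ∃ (m : ℕ) (x : X), 1 ≤ m ∧ t ⊆ Metric.ball x ((1 / 2) ^ m / 4) ∧
      ((2⁻¹ : ℝ≥0∞) ^ m) ^ s ≤ 8 ^ s * Metric.ediam t ^ s + η := by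
  suffices h : ∃ m : ℕ, 1 ≤ m ∧ Metric.ediam t < 2⁻¹ ^ (m + 2) ∧
      ((2⁻¹ : ℝ≥0∞) ^ m) ^ s ≤ 8 ^ s * Metric.ediam t ^ s + η by
    obtain ⟨m, hm, hd, hle⟩ := h
    rcases t.eq_empty_or_nonempty with rfl | ⟨x, hx⟩
    · exact ⟨m, Classical.arbitrary X, hm, empty_subset _, hle⟩
    · refine ⟨m, x, hm, fun y hy => ?_, hle⟩
      have h1 := (Metric.edist_le_ediam_of_mem hy hx).trans_lt hd
      have h2 : (2⁻¹ : ℝ≥0∞) ^ (m + 2) = ENNReal.ofReal ((1 / 2) ^ m / 4) := by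
        rw [show ((1 / 2 : ℝ) ^ m / 4) = (2⁻¹) ^ (m + 2) by rw [pow_add]; ring,
          ENNReal.ofReal_pow (by norm_num), ENNReal.ofReal_inv_of_pos (by norm_num)]
        simp
      rw [h2, edist_lt_ofReal] at h1
      exact h1
  have hlim : Filter.Tendsto (fun m : ℕ => ((2⁻¹ : ℝ≥0∞) ^ m) ^ s) Filter.atTop (𝓝 0) := by
    have h1 : Filter.Tendsto (fun m : ℕ => (2⁻¹ : ℝ≥0∞) ^ m) Filter.atTop (𝓝 0) :=
      ENNReal.tendsto_pow_atTop_nhds_zero_of_lt_one (by simp)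
    have h2 := (ENNReal.continuous_rpow_const (y := s)).tendsto 0 |>.comp h1
    simpa [ENNReal.zero_rpow_of_pos hs, Function.comp_def] using h2
  obtain ⟨m₀, hm₀, hm₀1⟩ := ((hlim.eventually_lt_const (pos_iff_ne_zero.2 hη)).and
    (Filter.eventually_ge_atTop 1)).exists
  by_cases hd : Metric.ediam t < 2⁻¹ ^ (m₀ + 2)
  · exact ⟨m₀, hm₀1, hd, hm₀.le.trans le_add_self⟩
  · have hex : ∃ p : ℕ, ¬ Metric.ediam t < 2⁻¹ ^ (p + 3) := by
      refine ⟨m₀ - 1, ?_⟩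
      rwa [show m₀ - 1 + 3 = m₀ + 2 by omega]
    classical
    -- the first scale `p` that fails is positive, and the scale before it is the one to use
    obtain ⟨p, hp⟩ : ∃ p, Nat.find hex = p + 1 := by
      refine ⟨Nat.find hex - 1, ?_⟩
      have : Nat.find hex ≠ 0 := fun h0 => Nat.find_spec hex (by rw [h0]; simpa using ht)
      omega
    refine ⟨p + 1, by omega, not_not.1 (Nat.find_min hex (m := p) (by omega)), ?_⟩
    have hfail := not_lt.1 (Nat.find_spec hex)
    rw [hp] at hfail
    refine le_trans ?_ le_self_add
    rw [← ENNReal.mul_rpow_of_nonneg _ _ hs.le]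
    refine ENNReal.rpow_le_rpow ?_ hs.le
    refine le_trans (le_of_eq ?_) (mul_le_mul_right hfail 8)
    rw [pow_add _ (p + 1) 3, ← mul_assoc, mul_comm 8, mul_assoc]
    rw [show (8 : ℝ≥0∞) = 2 ^ 3 by norm_num, ← mul_pow, ENNReal.mul_inv_cancel (by simp) (by simp)]
    simp

open MeasureTheory Measure in
/-- A compact set of `s`-dimensional Hausdorff measure zero has a finite covering by balls of radii
`2^(-mᵢ) / 4` for which the sum of the `2^(-s mᵢ)` is at most one. -/
theorem exists_finite_cover_of_hausdorffMeasure_eq_zero {X : Type*} [MetricSpace X]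
    [MeasurableSpace X] [BorelSpace X] [Nonempty X] {s : ℝ} (hs : 0 < s) {K : Set X}
    (hK : IsCompact K) (h0 : μH[s] K = 0) :
    ∃ (F : Finset ℕ) (m : ℕ → ℕ) (x : ℕ → X), (∀ i, 1 ≤ m i) ∧
      K ⊆ ⋃ i ∈ F, Metric.ball (x i) ((1 / 2) ^ m i / 4) ∧
      ∑ i ∈ F, ((1 / 2 : ℝ) ^ m i) ^ s ≤ 1 := by
  have hc0 : (8 : ℝ≥0∞) ^ s ≠ 0 := by simp [ENNReal.rpow_eq_zero_iff]
  have hct : (8 : ℝ≥0∞) ^ s ≠ ⊤ := ENNReal.rpow_ne_top_of_nonneg hs.le (by simp)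
  rw [hausdorffMeasure_apply] at h0
  have h1 := (iSup₂_le_iff.1 h0.le) (2⁻¹ ^ 4) (ENNReal.pow_pos (by simp) 4)
  have h2 := lt_of_le_of_lt h1
    (ENNReal.div_pos (ENNReal.inv_ne_zero.2 hct) ENNReal.ofNat_ne_top :
      0 < ((8 : ℝ≥0∞) ^ s)⁻¹ / 2)
  simp only [iInf_lt_iff] at h2
  obtain ⟨t, hKt, hdiam, hsum⟩ := h2
  obtain ⟨η, hη, hηsum⟩ :=
    ENNReal.exists_pos_sum_of_countable (ε := 2⁻¹) (by simp) ℕ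
  have hlt : (2⁻¹ : ℝ≥0∞) ^ 4 < 2⁻¹ ^ 3 := by
    rw [← ENNReal.inv_pow, ← ENNReal.inv_pow, ENNReal.inv_lt_inv]
    norm_num
  choose m x hm hball hle using fun i =>
    exists_subset_ball_two_pow hs ((hdiam i).trans_lt hlt)
      (ENNReal.coe_ne_zero.2 (hη i).ne')
  have htot : ∑' i, ((2⁻¹ : ℝ≥0∞) ^ m i) ^ s ≤ 1 := by
    calc ∑' i, ((2⁻¹ : ℝ≥0∞) ^ m i) ^ s
        ≤ ∑' i, (8 ^ s * (⨆ _ : (t i).Nonempty, Metric.ediam (t i) ^ s) + η i) := by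
          refine ENNReal.tsum_le_tsum fun i => (hle i).trans ?_
          gcongr
          rcases (t i).eq_empty_or_nonempty with h | h
          · simp [h, hs]
          · simp [h]
      _ = 8 ^ s * ∑' i, (⨆ _ : (t i).Nonempty, Metric.ediam (t i) ^ s) + ∑' i, (η i : ℝ≥0∞) := by
          rw [ENNReal.tsum_add, ENNReal.tsum_mul_left]
      _ ≤ 8 ^ s * (((8 : ℝ≥0∞) ^ s)⁻¹ / 2) + 2⁻¹ := by gcongr
      _ = 1 := by
          rw [← mul_div_assoc, ENNReal.mul_inv_cancel hc0 hct, one_div, ENNReal.inv_two_add_inv_two]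
  obtain ⟨F, hF⟩ := hK.elim_finite_subcover (fun i => Metric.ball (x i) ((1 / 2) ^ m i / 4))
    (fun i => Metric.isOpen_ball) (hKt.trans (iUnion_mono hball))
  refine ⟨F, m, x, hm, hF, ?_⟩
  have hFsum := (ENNReal.sum_le_tsum F).trans htot
  have heq : ∀ i, ((2⁻¹ : ℝ≥0∞) ^ m i) ^ s = ENNReal.ofReal (((1 / 2 : ℝ) ^ m i) ^ s) := by
    intro i
    rw [← ENNReal.ofReal_rpow_of_nonneg (by positivity) hs.le, ENNReal.ofReal_pow (by norm_num),
      one_div, ENNReal.ofReal_inv_of_pos (by norm_num)]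
    simp
  simp only [heq] at hFsum
  rw [← ENNReal.ofReal_sum_of_nonneg fun i _ => by positivity] at hFsum
  exact ENNReal.ofReal_le_one.1 hFsum

open MeasureTheory Measure in
/-- For a compact set invariant under doubling, Hausdorff measure zero in dimension `s` bounds the
covering numbers at all scales: a covering by balls `Bᵢ` of radius `2^(-mᵢ) / 4` gives
`a n ≤ ∑ i, a (n - mᵢ)` for the covering numbers `a n` at scale `2⁻ⁿ`, as the `mᵢ`-th power of the
doubling map blows up `K ∩ Bᵢ` by `2 ^ mᵢ` into `K`. -/
theorem exists_coverableBy_of_hausdorffMeasure_eq_zero {s : ℝ} (hs : 0 < s)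
    {K : Set UnitAddCircle} (hK : IsCompact K) (hinv : doublingMap '' K ⊆ K)
    (h0 : μH[s] K = 0) :
    ∃ C : ℝ, ∀ n : ℕ, ∃ N : ℕ, (N : ℝ) ≤ C * ((2 : ℝ) ^ n) ^ s ∧
      CoverableBy K N ((1 / 2) ^ n) := by
  obtain ⟨F, m, x, hm, hcov, hsum⟩ := exists_finite_cover_of_hausdorffMeasure_eq_zero hs hK h0
  obtain ⟨N₀, hN₀⟩ := CoverableBy.exists_of_isCompact hK
    (δ := (1 / 2) ^ F.sup m) (by positivity)
  refine ⟨N₀, fun n => ?_⟩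
  induction n using Nat.strong_induction_on with
  | _ n ih =>
    by_cases hn : n ≤ F.sup m
    · refine ⟨N₀, le_mul_of_one_le_right (Nat.cast_nonneg _) ?_, hN₀.mono Subset.rfl le_rfl ?_⟩
      · exact Real.one_le_rpow (one_le_pow₀ (by norm_num)) hs.le
      · exact pow_le_pow_of_le_one (by norm_num) (by norm_num) hn
    · have hmn : ∀ i ∈ F, m i ≤ n := fun i hi => (Finset.le_sup hi).trans (not_le.1 hn).le
      have hlt : ∀ i ∈ F, n - m i < n := fun i hi => by
        have := hm i
        have := hmn i hi
        omega
      have ih' : ∀ i, ∃ N : ℕ, i ∈ F → (N : ℝ) ≤ N₀ * ((2 : ℝ) ^ (n - m i)) ^ s ∧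
          CoverableBy K N ((1 / 2) ^ (n - m i)) := by
        intro i
        by_cases hi : i ∈ F
        · obtain ⟨N, hN⟩ := ih _ (hlt i hi)
          exact ⟨N, fun _ => hN⟩
        · exact ⟨0, fun h => absurd h hi⟩
      choose N hN using ih'
      refine ⟨∑ i ∈ F, N i, ?_, ?_⟩
      · push_cast
        calc ∑ i ∈ F, (N i : ℝ) ≤ ∑ i ∈ F, N₀ * ((2 : ℝ) ^ n) ^ s * ((1 / 2 : ℝ) ^ m i) ^ s := by
              refine Finset.sum_le_sum fun i hi => (hN i hi).1.trans (le_of_eq ?_)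
              rw [mul_assoc, ← Real.mul_rpow (by positivity) (by positivity)]
              congr 2
              rw [one_div, inv_pow, pow_sub₀ _ two_ne_zero (hmn i hi)]
          _ = N₀ * ((2 : ℝ) ^ n) ^ s * ∑ i ∈ F, ((1 / 2 : ℝ) ^ m i) ^ s := by
              rw [Finset.mul_sum]
          _ ≤ N₀ * ((2 : ℝ) ^ n) ^ s := mul_le_of_le_one_right (by positivity) hsum
      · have hpiece : ∀ i ∈ F, CoverableBy (K ∩ Metric.ball (x i) ((1 / 2) ^ m i / 4)) (N i)
            ((1 / 2) ^ n) := by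
          intro i hi
          have h := (hN i hi).2.of_two_pow_nsmul (m := m i)
            (A := K ∩ Metric.ball (x i) ((1 / 2) ^ m i / 4))
            (fun y hy => two_pow_nsmul_mem hinv hy.1 _) ?_
          · refine h.mono Subset.rfl le_rfl (le_of_eq ?_)
            rw [div_eq_mul_inv, ← inv_pow, ← one_div, ← pow_add, Nat.sub_add_cancel (hmn i hi)]
          · intro y hy z hz
            have h1 := Metric.mem_ball.1 hy.2
            have h2 := Metric.mem_ball.1 hz.2
            have h3 := dist_triangle_right y z (x i)
            rw [div_eq_mul_inv, ← inv_pow, ← one_div]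
            linarith
        refine (CoverableBy.biUnion hpiece).mono ?_ le_rfl le_rfl
        intro y hy
        obtain ⟨i, hi, hyi⟩ := mem_iUnion₂.1 (hcov hy)
        exact mem_iUnion₂.2 ⟨i, hi, hy, hyi⟩

/-! ### A countable family of compact sets -/

/-- The points whose orbit under `x ↦ 2 ^ n • x` stays in the union of the closed balls of radius
`2⁻ⁿ / 4` centred at the terms of a fixed dense sequence with index in `C`. -/
def confinedSet (n : ℕ) (C : Finset ℕ) : Set UnitAddCircle :=
  {x | ∀ k : ℕ, 2 ^ (n * k) • x ∈
    ⋃ c ∈ C, Metric.closedBall (TopologicalSpace.denseSeq UnitAddCircle c) ((1 / 2) ^ n / 4)}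

theorem isCompact_confinedSet (n : ℕ) (C : Finset ℕ) : IsCompact (confinedSet n C) := by
  have h : confinedSet n C = ⋂ k : ℕ, (fun x : UnitAddCircle => 2 ^ (n * k) • x) ⁻¹'
      ⋃ c ∈ C, Metric.closedBall (TopologicalSpace.denseSeq UnitAddCircle c) ((1 / 2) ^ n / 4) := by
    ext x
    simp [confinedSet]
  rw [h]
  exact (isClosed_iInter fun k => (C.finite_toSet.isClosed_biUnion
    fun c _ => Metric.isClosed_closedBall).preimage (continuous_nsmul _)).isCompact

theorem mapsTo_confinedSet (n : ℕ) (C : Finset ℕ) :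
    MapsTo (fun x => 2 ^ n • x) (confinedSet n C) (confinedSet n C) := by
  intro x hx k
  have := hx (k + 1)
  rwa [mul_add, mul_one, pow_add, mul_smul] at this

theorem coverableBy_confinedSet (n : ℕ) (C : Finset ℕ) (k : ℕ) :
    CoverableBy (confinedSet n C) (C.card ^ k) (1 / 2 / 2 ^ (n * k)) := by
  induction k with
  | zero =>
    refine ⟨{univ}, by simp, fun S _ x _ y _ => by simpa using dist_le_half x y, ?_⟩
    simp
  | succ k ih =>
    have hpiece : ∀ c ∈ C, CoverableBy (confinedSet n C ∩
        Metric.closedBall (TopologicalSpace.denseSeq UnitAddCircle c) ((1 / 2) ^ n / 4))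
        (C.card ^ k) (1 / 2 / 2 ^ (n * k) / 2 ^ n) := by
      refine fun c _ => ih.of_two_pow_nsmul (fun x hx => mapsTo_confinedSet n C hx.1) ?_
      intro y hy z hz
      have h1 := Metric.mem_closedBall.1 hy.2
      have h2 := Metric.mem_closedBall.1 hz.2
      have h3 := dist_triangle_right y z (TopologicalSpace.denseSeq UnitAddCircle c)
      rw [div_eq_mul_inv (1 / 2 : ℝ), ← inv_pow, ← one_div]
      linarith
    refine (CoverableBy.biUnion hpiece).mono ?_ ?_ ?_
    · intro x hx
      obtain ⟨c, hc, hxc⟩ := mem_iUnion₂.1 (hx 0)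
      exact mem_iUnion₂.2 ⟨c, hc, hx, by simpa using hxc⟩
    · rw [Finset.sum_const, smul_eq_mul, pow_succ']
    · rw [div_div, ← pow_add, mul_add, mul_one]

open MeasureTheory Measure in
/-- The invariant sets of Hausdorff dimension less than `1 / 2` are contained in members of the
countable family of those `confinedSet n C` for which `|C| ^ 2 < 2 ^ n`. -/
theorem exists_subset_confinedSet {K : Set UnitAddCircle}
    (hK : K ∈ compactInvariantSets doublingMap) (hdim : dimH K < 1 / 2) :
    ∃ (n : ℕ) (C : Finset ℕ), C.card ^ 2 < 2 ^ n ∧ K ⊆ confinedSet n C := by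
  obtain ⟨s, hs1, hs2⟩ := ENNReal.lt_iff_exists_nnreal_btwn.1 hdim
  have hs0 : 0 < (s : ℝ) := by
    have : (0 : ℝ≥0∞) < s := zero_le.trans_lt hs1
    exact_mod_cast this
  have hs2' : 2 * (s : ℝ) < 1 := by
    have h : (s : ℝ≥0∞) < ((1 / 2 : NNReal) : ℝ≥0∞) := by simpa using hs2
    have h' : (s : ℝ) < ((1 / 2 : NNReal) : ℝ) := by exact_mod_cast h
    push_cast at h'
    linarith
  obtain ⟨B, hB⟩ := exists_coverableBy_of_hausdorffMeasure_eq_zero hs0 hK.1 hK.2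
    (hausdorffMeasure_of_dimH_lt hs1)
  -- the covering numbers squared grow like `q ^ n`, with `q < 2`
  set q : ℝ := (2 : ℝ) ^ (2 * (s : ℝ)) with hq
  have hq2 : q < 2 := by
    simpa using Real.rpow_lt_rpow_of_exponent_lt (x := 2) (by norm_num) hs2'
  have hq0 : 0 < q := by positivity
  have hpow : ∀ n : ℕ, (((2 : ℝ) ^ n) ^ (s : ℝ)) ^ 2 = q ^ n := by
    intro n
    rw [hq, ← Real.rpow_natCast, ← Real.rpow_natCast, ← Real.rpow_natCast, ← Real.rpow_mul,
      ← Real.rpow_mul, ← Real.rpow_mul] <;> try positivity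
    congr 1
    push_cast
    ring
  obtain ⟨n, hn⟩ : ∃ n : ℕ, B ^ 2 * q ^ 3 * (q / 2) ^ n < 1 := by
    have h1 := (tendsto_pow_atTop_nhds_zero_of_lt_one (r := q / 2) (by positivity)
      (by linarith)).const_mul (B ^ 2 * q ^ 3)
    rw [mul_zero] at h1
    exact (h1.eventually_lt_const one_pos).exists
  -- a covering at a scale finer than `2⁻ⁿ / 4` leaves room for moving the centres
  obtain ⟨N, hN, hcov⟩ := hB (n + 3)
  obtain ⟨C, hC, hsub⟩ := hcov.exists_finset_closedBall (ε := (1 / 2) ^ n / 4)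
    (TopologicalSpace.denseRange_denseSeq UnitAddCircle) (by
      have : (0 : ℝ) < (1 / 2) ^ n := by positivity
      rw [pow_add]
      linarith)
  refine ⟨n, C, ?_, fun x hx k => hsub (two_pow_nsmul_mem hK.2 hx _)⟩
  have h1 : (C.card : ℝ) ^ 2 < 2 ^ n := by
    calc (C.card : ℝ) ^ 2 ≤ (B * ((2 : ℝ) ^ (n + 3)) ^ (s : ℝ)) ^ 2 := by
          have : (C.card : ℝ) ≤ N := by exact_mod_cast hC
          exact pow_le_pow_left₀ (Nat.cast_nonneg _) (this.trans hN) 2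
      _ = B ^ 2 * q ^ 3 * (q / 2) ^ n * 2 ^ n := by
          rw [mul_pow, hpow, div_pow, pow_add]
          field_simp
      _ < 1 * 2 ^ n := by gcongr
      _ = 2 ^ n := one_mul _
  exact_mod_cast h1

/-! ### Almost every rotation -/

open MeasureTheory in
/-- If `A` has covering numbers `N` with `N ^ 2 * δ` arbitrarily small (as is the case when its
lower box dimension is less than `1 / 2`) and `f` is Lipschitz, then the set `A - f(A)` of the `t`
for which `f + t` does not displace `A` has measure zero. -/
theorem volume_setOf_add_mem_eq_zero {A : Set UnitAddCircle} {f : UnitAddCircle → UnitAddCircle}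
    {L : NNReal} (hf : LipschitzWith L f)
    (hA : ∀ ε : ℝ, 0 < ε → ∃ (N : ℕ) (δ : ℝ), CoverableBy A N δ ∧ (N : ℝ) ^ 2 * δ < ε) :
    volume {t : UnitAddCircle | ∃ x ∈ A, f x + t ∈ A} = 0 := by
  classical
  have hbound : ∀ (N : ℕ) (δ : ℝ), CoverableBy A N δ →
      volume {t : UnitAddCircle | ∃ x ∈ A, f x + t ∈ A} ≤
        ENNReal.ofReal ((N : ℝ) ^ 2 * δ * (2 * (1 + L))) := by
    rintro N δ ⟨𝒮, hcard, hdiam, hsub⟩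
    rcases lt_or_ge δ 0 with hδ | hδ
    · have hempty : A = ∅ := by
        rw [eq_empty_iff_forall_notMem]
        intro x hx
        obtain ⟨S, hS, hxS⟩ := mem_iUnion₂.1 (hsub hx)
        have := hdiam S hS x hxS x hxS
        rw [dist_self] at this
        linarith
      simp [hempty]
    have hpair : ∀ p ∈ 𝒮 ×ˢ 𝒮,
        volume {t : UnitAddCircle | ∃ x ∈ p.1, f x + t ∈ p.2} ≤
          ENNReal.ofReal (2 * ((1 + L) * δ)) := by
      rintro ⟨S, S'⟩ hp
      obtain ⟨hS, hS'⟩ := Finset.mem_product.1 hp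
      rcases {t : UnitAddCircle | ∃ x ∈ S, f x + t ∈ S'}.eq_empty_or_nonempty with he | ⟨t₀, ht₀⟩
      · simp [he]
      · obtain ⟨x₀, hx₀, hy₀⟩ := ht₀
        refine (measure_mono (t := Metric.closedBall t₀ ((1 + L) * δ)) ?_).trans ?_
        · rintro t ⟨x, hx, hy⟩
          have h1 := hdiam S' hS' _ hy _ hy₀
          have h2 := (hf.dist_le_mul x x₀).trans
            (mul_le_mul_of_nonneg_left (hdiam S hS x hx x₀ hx₀) L.2)
          have h3 : dist t t₀ ≤ dist (f x + t) (f x₀ + t₀) + dist (f x) (f x₀) := by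
            rw [dist_eq_norm, dist_eq_norm, dist_eq_norm]
            refine le_trans (le_of_eq ?_) (norm_sub_le _ _)
            congr 1
            abel
          rw [Metric.mem_closedBall]
          have h4 : dist (f x) (f x₀) ≤ (L : ℝ) * δ := h2
          linarith
        · rw [AddCircle.volume_closedBall]
          exact ENNReal.ofReal_le_ofReal (min_le_right _ _)
    calc volume {t : UnitAddCircle | ∃ x ∈ A, f x + t ∈ A}
        ≤ volume (⋃ p ∈ 𝒮 ×ˢ 𝒮, {t : UnitAddCircle | ∃ x ∈ p.1, f x + t ∈ p.2}) := by
          refine measure_mono ?_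
          rintro t ⟨x, hx, hy⟩
          obtain ⟨S, hS, hxS⟩ := mem_iUnion₂.1 (hsub hx)
          obtain ⟨S', hS', hyS'⟩ := mem_iUnion₂.1 (hsub hy)
          exact mem_iUnion₂.2 ⟨(S, S'), Finset.mem_product.2 ⟨hS, hS'⟩, x, hxS, hyS'⟩
      _ ≤ ∑ p ∈ 𝒮 ×ˢ 𝒮, volume {t : UnitAddCircle | ∃ x ∈ p.1, f x + t ∈ p.2} :=
          measure_biUnion_finset_le _ _
      _ ≤ ∑ _p ∈ 𝒮 ×ˢ 𝒮, ENNReal.ofReal (2 * ((1 + L) * δ)) := Finset.sum_le_sum hpair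
      _ = ENNReal.ofReal ((𝒮.card : ℝ) ^ 2 * (2 * ((1 + L) * δ))) := by
          rw [Finset.sum_const, Finset.card_product, nsmul_eq_mul,
            ENNReal.ofReal_mul (p := (𝒮.card : ℝ) ^ 2) (by positivity),
            ← Nat.cast_pow, ENNReal.ofReal_natCast, sq]
      _ ≤ ENNReal.ofReal ((N : ℝ) ^ 2 * δ * (2 * (1 + L))) := by
          refine ENNReal.ofReal_le_ofReal ?_
          have hc : (𝒮.card : ℝ) ≤ N := by exact_mod_cast hcard
          calc (𝒮.card : ℝ) ^ 2 * (2 * ((1 + L) * δ)) ≤ (N : ℝ) ^ 2 * (2 * ((1 + L) * δ)) := by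
                gcongr
            _ = _ := by ring
  rw [← nonpos_iff_eq_zero]
  refine le_of_forall_gt_imp_ge_of_dense fun ε hε => ?_
  rcases eq_or_ne ε ⊤ with rfl | hεt
  · exact le_top
  have hL : (0 : ℝ) < 2 * (1 + L) := by positivity
  obtain ⟨N, δ, hcov, hlt⟩ := hA (ε.toReal / (2 * (1 + L)))
    (div_pos (ENNReal.toReal_pos hε.ne' hεt) hL)
  refine (hbound N δ hcov).trans (ENNReal.ofReal_le_of_le_toReal ?_)
  rw [lt_div_iff₀ hL] at hlt
  exact hlt.le

open MeasureTheory in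
theorem volume_setOf_add_mem_confinedSet_eq_zero {f : UnitAddCircle → UnitAddCircle} {L : NNReal}
    (hf : LipschitzWith L f) {n : ℕ} {C : Finset ℕ} (hC : C.card ^ 2 < 2 ^ n) :
    volume {t : UnitAddCircle | ∃ x ∈ confinedSet n C, f x + t ∈ confinedSet n C} = 0 := by
  refine volume_setOf_add_mem_eq_zero hf fun ε hε => ?_
  have hr : (C.card : ℝ) ^ 2 / 2 ^ n < 1 := by
    rw [div_lt_one (by positivity)]
    exact_mod_cast hC
  obtain ⟨k, hk⟩ := exists_pow_lt_of_lt_one hε hr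
  refine ⟨_, _, coverableBy_confinedSet n C k, lt_of_le_of_lt ?_ hk⟩
  have h : ((C.card ^ k : ℕ) : ℝ) ^ 2 * (1 / 2 / 2 ^ (n * k)) =
      1 / 2 * ((C.card : ℝ) ^ 2 / 2 ^ n) ^ k := by
    rw [div_pow, ← pow_mul, ← pow_mul, Nat.cast_pow, ← pow_mul, mul_comm k 2]
    ring
  rw [h]
  have : 0 ≤ ((C.card : ℝ) ^ 2 / 2 ^ n) ^ k := by positivity
  linarith

open MeasureTheory in
/-- One arbitrarily small rotation displaces all members of the countable family at once: for each
member only a null set of angles is bad. -/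
theorem exists_rotation_forall_confinedSet {f : UnitAddCircle → UnitAddCircle} {L : NNReal}
    (hf : LipschitzWith L f) {ε : ℝ} (hε : 0 < ε) :
    ∃ t : ℝ, |t| < ε ∧ ∀ (n : ℕ) (C : Finset ℕ), C.card ^ 2 < 2 ^ n →
      ∀ x ∈ confinedSet n C, f x + (t : UnitAddCircle) ∉ confinedSet n C := by
  have hnull : ∀ᵐ t : UnitAddCircle, ∀ p : {p : ℕ × Finset ℕ // p.2.card ^ 2 < 2 ^ p.1},
      ¬ ∃ x ∈ confinedSet p.1.1 p.1.2, f x + t ∈ confinedSet p.1.1 p.1.2 := by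
    rw [ae_all_iff]
    intro p
    rw [ae_iff]
    simpa only [not_not] using volume_setOf_add_mem_confinedSet_eq_zero hf p.2
  obtain ⟨y, hy, hdist⟩ := (Measure.dense_of_ae hnull).exists_dist_lt 0 hε
  obtain ⟨t, rfl, ht⟩ := exists_coe_eq_abs_eq_norm y
  exact ⟨t, by rwa [ht, ← dist_zero_left],
    fun n C hC x hx hmem => hy ⟨(n, C), hC⟩ ⟨x, hx, hmem⟩⟩

/-! ### Rotations of expanding Markov maps -/

theorem contDiff_one_of_isClassC {α : ℝ≥0∞} (hα : 1 < α) {F : ℝ → ℝ} (hF : IsClassC α F) :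
    ContDiff ℝ 1 F := by
  by_cases h : α = ⊤
  · exact (hF.1 h).of_le (by exact_mod_cast le_top)
  · refine (hF.2 h).1.of_le ?_
    have h1 : 1 ≤ α.toReal := by
      rw [← ENNReal.toReal_one]
      exact ENNReal.toReal_mono h hα.le
    exact_mod_cast (Nat.one_le_floor_iff _).2 h1

namespace ExpandingMarkovMap

variable {α : ℝ≥0∞}

theorem exists_lipschitzWith (hα : 1 < α) (f : ExpandingMarkovMap α) :
    ∃ L : NNReal, LipschitzWith L f := by
  obtain ⟨F, hlift, -, hF, -⟩ := f.exists_lift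
  obtain ⟨L, hL⟩ := (contDiff_one_of_isClassC hα hF).locallyLipschitz.locallyLipschitzOn
    |>.exists_lipschitzOnWith_of_compact (isCompact_Icc (a := (-1 : ℝ)) (b := 2))
  refine ⟨L, LipschitzWith.of_dist_le_mul fun x y => ?_⟩
  -- lift `x` to `[0, 1]` and `y` to a point at distance `dist x y ≤ 1 / 2` of that lift
  obtain ⟨a, ha, rfl⟩ := (AddCircle.coe_image_Icc_eq (1 : ℝ) 0 ▸ mem_univ x :
    x ∈ ((↑) : ℝ → UnitAddCircle) '' Icc 0 (0 + 1))
  obtain ⟨t, ht, hn⟩ := exists_coe_eq_abs_eq_norm (y - (a : UnitAddCircle))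
  have hy : y = ((a + t : ℝ) : UnitAddCircle) := by
    rw [AddCircle.coe_add, ht, add_sub_cancel]
  have hd : dist (a : UnitAddCircle) y = |t| := by rw [dist_comm, dist_eq_norm, hn]
  have ht2 : |t| ≤ 1 / 2 := hd ▸ dist_le_half _ _
  rw [abs_le] at ht2
  have h := hL.dist_le_mul a ⟨by linarith [ha.1], by linarith [ha.2]⟩ (a + t)
    ⟨by linarith [ha.1, ht2.1], by linarith [ha.2, ht2.2]⟩
  rw [hd]
  calc dist (f a) (f y) = ‖((F a - F (a + t) : ℝ) : UnitAddCircle)‖ := by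
        rw [hy, dist_eq_norm, AddCircle.coe_sub, hlift, hlift]
    _ ≤ |F a - F (a + t)| := norm_coe_le_abs _
    _ ≤ L * |t| := by simpa [Real.dist_eq] using h

theorem iteratedDeriv_add_const_of_one_le {F : ℝ → ℝ} {j : ℕ} (hj : 1 ≤ j) (t : ℝ) :
    iteratedDeriv j (fun s => F s + t) = iteratedDeriv j F := by
  obtain ⟨i, rfl⟩ : ∃ i, j = i + 1 := ⟨j - 1, by omega⟩
  rw [iteratedDeriv_succ', iteratedDeriv_succ']
  congr 1
  funext s
  exact deriv_add_const _

theorem isClassC_add_const (hα : 1 < α) {F : ℝ → ℝ} (hF : IsClassC α F) (t : ℝ) :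
    IsClassC α fun s => F s + t := by
  refine ⟨fun h => (hF.1 h).add contDiff_const, fun h => ⟨(hF.2 h).1.add contDiff_const, ?_⟩⟩
  have h1 : 1 ≤ α.toReal := by
    rw [← ENNReal.toReal_one]
    exact ENNReal.toReal_mono h hα.le
  rw [iteratedDeriv_add_const_of_one_le ((Nat.one_le_floor_iff _).2 h1)]
  exact (hF.2 h).2

/-- The map `f` followed by the rotation by `t`. -/
def rotate (hα : 1 < α) (f : ExpandingMarkovMap α) (t : ℝ) : ExpandingMarkovMap α where
  toFun x := f x + (t : UnitAddCircle)
  isLocalHomeomorph :=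
    (Homeomorph.addRight (t : UnitAddCircle)).isLocalHomeomorph.comp f.isLocalHomeomorph
  exists_lift := by
    obtain ⟨F, hlift, hcont, hF, γ, hγ, hγF⟩ := f.exists_lift
    refine ⟨fun s => F s + t, fun s => by rw [AddCircle.coe_add, hlift s],
      hcont.add continuous_const, isClassC_add_const hα hF t, γ, hγ, fun s => ?_⟩
    rw [deriv_add_const]
    exact hγF s
  exists_partition := by
    obtain ⟨n, x, hx, hlast, h⟩ := f.exists_partition
    refine ⟨n, x, hx, hlast, fun i => ⟨fun y hy z hz hyz => (h i).1 hy hz ?_, ?_⟩⟩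
    · exact add_right_cancel hyz
    · have himage := image_comp (fun y : UnitAddCircle => y + (t : UnitAddCircle)) f
        ((fun t : ℝ => (t : UnitAddCircle)) '' Icc (x i.castSucc) (x i.succ))
      rw [(h i).2, image_univ] at himage
      exact himage.trans (Homeomorph.addRight (t : UnitAddCircle)).surjective.range_eq

theorem rotate_apply (hα : 1 < α) (f : ExpandingMarkovMap α) (t : ℝ) (x : UnitAddCircle) :
    f.rotate hα t x = f x + (t : UnitAddCircle) := rfl

theorem derivative_rotate (hα : 1 < α) (f : ExpandingMarkovMap α) (t : ℝ) {j : ℕ} (hj : 1 ≤ j) :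
    (f.rotate hα t).derivative j = f.derivative j := by
  rw [derivative_eq (G := fun s => f.lift s + t) _ (f.continuous_lift.add continuous_const) _ hj,
    iteratedDeriv_add_const_of_one_le hj]
  · rfl
  · intro s
    rw [AddCircle.coe_add, f.isLift_lift s]
    rfl

/-- A rotation changes no derivative, so in every `C^s` distance it moves `f` by its angle. -/
theorem cDist_rotate_le (hα : 1 < α) (f : ExpandingMarkovMap α) (t : ℝ) {s : ℝ} (hs : 1 ≤ s) :
    cDist s (f.rotate hα t) f ≤ ENNReal.ofReal |t| := by
  have hfl : 1 ≤ ⌊s⌋₊ := (Nat.one_le_floor_iff _).2 hs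
  have h1 : ∑ j ∈ Finset.Icc 1 ⌊s⌋₊, supDist ((f.rotate hα t).derivative j) (f.derivative j) = 0 :=
    Finset.sum_eq_zero fun j hj => by
      rw [derivative_rotate hα f t (Finset.mem_Icc.1 hj).1]
      simp [supDist]
  have h2 : ∀ b : ℝ, holderDist b ((f.rotate hα t).derivative ⌊s⌋₊) (f.derivative ⌊s⌋₊) = 0 := by
    intro b
    rw [derivative_rotate hα f t hfl]
    simp [holderDist]
  rw [cDist, h1, h2, ite_self, add_zero, add_zero]
  refine iSup_le fun x => ?_
  rw [edist_dist, dist_eq_norm, rotate_apply, add_sub_cancel_left]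
  exact ENNReal.ofReal_le_ofReal (norm_coe_le_abs t)

theorem topology_eq_of_eq_top (h : α = ⊤) : (instTopologicalSpace : TopologicalSpace
    (ExpandingMarkovMap α)) =
      ⨅ k : ℕ, (cMetric α ((k + 1 : ℕ) : ℝ)).toUniformSpace.toTopologicalSpace :=
  if_pos h

theorem topology_eq_of_ne_top (h : α ≠ ⊤) : (instTopologicalSpace : TopologicalSpace
    (ExpandingMarkovMap α)) = (cMetric α α.toReal).toUniformSpace.toTopologicalSpace :=
  if_neg h

theorem tendsto_rotate (hα : 1 < α) (f : ExpandingMarkovMap α) {t : ℕ → ℝ}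
    (ht : Filter.Tendsto t Filter.atTop (𝓝 0)) :
    Filter.Tendsto (fun n => f.rotate hα (t n)) Filter.atTop (𝓝 f) := by
  have key : ∀ s : ℝ, 1 ≤ s → Filter.Tendsto (fun n => f.rotate hα (t n)) Filter.atTop
      (@nhds _ (cMetric α s).toUniformSpace.toTopologicalSpace f) := by
    intro s hs
    let _ := cMetric α s
    refine tendsto_iff_edist_tendsto_0.2 (tendsto_of_tendsto_of_tendsto_of_le_of_le
      (h := fun n => ENNReal.ofReal |t n|) tendsto_const_nhds ?_
      (fun n => zero_le) (fun n => cDist_rotate_le hα f (t n) hs))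
    simpa using ENNReal.tendsto_ofReal ht.abs
  by_cases h : α = ⊤
  · rw [topology_eq_of_eq_top h, nhds_iInf, Filter.tendsto_iInf]
    exact fun k => key _ (by push_cast; linarith [(Nat.cast_nonneg k : (0 : ℝ) ≤ k)])
  · rw [topology_eq_of_ne_top h]
    refine key _ ?_
    rw [← ENNReal.toReal_one]
    exact ENNReal.toReal_mono h hα.le

theorem isOpen_of_forall_iSup_edist_lt {U : Set (ExpandingMarkovMap α)}
    (hU : ∀ f ∈ U, ∃ ε : ℝ≥0∞, 0 < ε ∧ ∀ g : ExpandingMarkovMap α,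
      (⨆ x, edist (g x) (f x)) < ε → g ∈ U) : IsOpen U := by
  have key : ∀ s : ℝ, @IsOpen _ (cMetric α s).toUniformSpace.toTopologicalSpace U := by
    intro s
    let _ := cMetric α s
    refine EMetric.isOpen_iff.2 fun f hf => ?_
    obtain ⟨ε, hε, h⟩ := hU f hf
    refine ⟨ε, hε, fun g hg => h g (lt_of_le_of_lt ?_ hg)⟩
    change _ ≤ cDist s g f
    rw [cDist, add_assoc]
    exact le_self_add
  by_cases h : α = ⊤
  · rw [topology_eq_of_eq_top h]
    exact iInf_le (fun k : ℕ =>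
      (cMetric α ((k + 1 : ℕ) : ℝ)).toUniformSpace.toTopologicalSpace) 0 _ (key _)
  · rw [topology_eq_of_ne_top h]
    exact key _

theorem isOpen_setOf_disjoint_image {A : Set UnitAddCircle} (hA : IsCompact A) :
    IsOpen {f : ExpandingMarkovMap α | Disjoint (f '' A) A} := by
  refine isOpen_of_forall_iSup_edist_lt fun f hf => ?_
  obtain ⟨δ, hδ, hdisj⟩ := Disjoint.exists_thickenings hf
    (hA.image f.isLocalHomeomorph.continuous) hA.isClosed
  refine ⟨ENNReal.ofReal δ, ENNReal.ofReal_pos.2 hδ, fun g hg => ?_⟩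
  refine hdisj.mono ?_ (Metric.self_subset_thickening hδ A)
  rintro _ ⟨x, hx, rfl⟩
  refine Metric.mem_thickening_iff.2 ⟨f x, mem_image_of_mem f hx, ?_⟩
  rw [← edist_lt_ofReal]
  exact (le_iSup (fun x => edist (g x) (f x)) x).trans_lt hg

end ExpandingMarkovMap

end

theorem mainTheorem3 (α : ℝ≥0∞) (hα : 1 < α) :
    ∃ G : Set (ExpandingMarkovMap α), IsGδ G ∧ Dense G ∧
      ∀ f ∈ G, ∀ K ∈ compactInvariantSets doublingMap, dimH K < 1 / 2 → f '' K ∩ K = ∅ := by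
  let I := {p : ℕ × Finset ℕ // p.2.card ^ 2 < 2 ^ p.1}
  refine ⟨⋂ p : I, {f | Disjoint (f '' confinedSet p.1.1 p.1.2) (confinedSet p.1.1 p.1.2)},
    IsGδ.iInter_of_isOpen fun p =>
      ExpandingMarkovMap.isOpen_setOf_disjoint_image (isCompact_confinedSet _ _), ?_, ?_⟩
  · intro f
    obtain ⟨L, hL⟩ := f.exists_lipschitzWith hα
    choose t ht htp using fun n : ℕ =>
      exists_rotation_forall_confinedSet hL (ε := 1 / ((n : ℝ) + 1)) (by positivity)
    refine mem_closure_of_tendsto (f.tendsto_rotate hα (t := t)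
      (squeeze_zero_norm (fun n => (ht n).le) tendsto_one_div_add_atTop_nhds_zero_nat))
      (Filter.Eventually.of_forall fun n => mem_iInter.2 fun p => ?_)
    rw [mem_ofPred_eq, disjoint_left]
    rintro _ ⟨x, hx, rfl⟩
    exact htp n p.1.1 p.1.2 p.2 x hx
  · intro f hf K hK hdim
    obtain ⟨n, C, hC, hsub⟩ := exists_subset_confinedSet hK hdim
    exact ((mem_iInter.1 hf ⟨(n, C), hC⟩).mono (image_mono hsub) hsub).inter_eq
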